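/- Fix a real number $b>0$. For $\nu,x\in\mathbb C$ let $$y_{\mathrm{even}}(\nu,x)=e^{-x^2/4}\sum_{k\ge 0}\Big(\prod_{j=0}^{k-1}(-\nu+2j)\Big)\frac{x^{2k}}{(2k)!},\qquad y_{\mathrm{odd}}(\nu,x)=e^{-x^2/4}\sum_{k\ge 0}\Big(\prod_{j=0}^{k-1}(-\nu+1+2j)\Big)\frac{x^{2k+1}}{(2k+1)!}$$ be the even and odd solutions of the Weber equation $-y''+\big(\tfrac{x^2}{4}-\tfrac12\big)y=\nu y$, and let $$D_\nu(x)=\frac{2^{\nu/2}\sqrt\pi}{\Gamma\left(-\frac{\nu}{2}+\frac12\right)}\,y_{\mathrm{even}}(\nu,x)-\frac{2^{(\nu+1)/2}\sqrt\pi}{\Gamma\left(-\frac{\nu}{2}\right)}\,y_{\mathrm{odd}}(\nu,x)$$ be the parabolic cylinder function (where $1/\Gamma$ is the entire reciprocal Gamma function). Put $$\mathsf D(\nu)=D_\nu(b),\qquad \Phi(\nu)=\sqrt{\tfrac2\pi}\;y_{\mathrm{even}}(\nu,b)\,y_{\mathrm{odd}}(\nu,b),\qquad \mathsf M(\nu)=\Gamma(-\nu)\,\mathsf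 D(\nu)^2\,\Phi(\nu)\quad(\nu\in\mathbb C\setminus\{0,1,2,\dots\}).$$ Let $n\ge 1$ be an integer with $\mathsf D(n)=0$. Then: (i) $n$ is a simple zero of $\mathsf D$ and a simple zero of $\Phi$. Moreover, $\mathsf M$ has a removable singularity at $n$, and its analytic continuation $\mathbf M$ to $n$, with $\mathbf M(n)=\lim_{\nu\to n}\mathsf M(\nu)$, has a zero of order exactly $2$ at $n$. (ii) There is a real number $c_2>0$ such that $\mathbf M(\nu)=c_2(\nu-n)^2+O\big((\nu-n)^3\big)$ as $\nu\to n$. -/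

import Mathlib

open Filter Topology Asymptotics

noncomputable section

/-- `k`-th term of the power series of `e^{x²/4} y_even(ν, x)`:
`(-ν)(-ν+2)⋯(-ν+2(k-1)) x^{2k} / (2k)!`. -/
def evenTerm (ν x : ℂ) (k : ℕ) : ℂ :=
  (∏ j ∈ Finset.range k, (-ν + 2 * (j : ℂ))) * x ^ (2 * k) / ((2 * k).factorial : ℂ)

/-- `k`-th term of the power series of `e^{x²/4} y_odd(ν, x)`:
`(-ν+1)(-ν+3)⋯(-ν+2k-1) x^{2k+1} / (2k+1)!`. -/
def oddTerm (ν x : ℂ) (k : ℕ) : ℂ :=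
  (∏ j ∈ Finset.range k, (-ν + 1 + 2 * (j : ℂ))) * x ^ (2 * k + 1) /
    ((2 * k + 1).factorial : ℂ)

/-- A ratio test: the series below converge for all values of the parameters. -/
theorem summable_of_weber_ratio (a C : ℂ) (f : ℕ → ℂ)
    (h : ∀ k, ‖f (k + 1)‖ ≤ ‖C‖ * ((‖a‖ + 2 * k) / ((2 * k + 1) * (2 * k + 2))) * ‖f k‖) :
    Summable f := by
  have hlim : Tendsto (fun k : ℕ => ‖C‖ * ((‖a‖ + 2) / ((k : ℝ) + 1))) atTop (𝓝 0) := by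
    have h1 : Tendsto (fun k : ℕ => (k : ℝ) + 1) atTop atTop :=
      tendsto_atTop_add_const_right _ _ tendsto_natCast_atTop_atTop
    simpa using (h1.const_div_atTop (‖a‖ + 2)).const_mul ‖C‖
  refine summable_of_ratio_norm_eventually_le (r := 1 / 2) (by norm_num) ?_
  filter_upwards [hlim.eventually (gt_mem_nhds (show (0 : ℝ) < 1 / 2 by norm_num))] with k hk
  refine (h k).trans (mul_le_mul_of_nonneg_right (le_trans ?_ hk.le) (norm_nonneg _))
  refine mul_le_mul_of_nonneg_left ?_ (norm_nonneg _)
  have hk0 : (0 : ℝ) ≤ k := Nat.cast_nonneg k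
  rw [div_le_div_iff₀ (by positivity) (by positivity)]
  nlinarith [norm_nonneg a, mul_nonneg (norm_nonneg a) hk0,
    mul_nonneg (mul_nonneg (norm_nonneg a) hk0) hk0, mul_nonneg hk0 hk0]

theorem summable_evenTerm (ν x : ℂ) : Summable (evenTerm ν x) := by
  refine summable_of_weber_ratio ν (x ^ 2) _ fun k => ?_
  have h0 : (((2 * k).factorial : ℕ) : ℂ) ≠ 0 := by exact_mod_cast Nat.factorial_ne_zero _
  have h1 : (2 * (k : ℂ) + 1) ≠ 0 := by exact_mod_cast Nat.succ_ne_zero (2 * k)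
  have h2 : (2 * (k : ℂ) + 2) ≠ 0 := by exact_mod_cast Nat.succ_ne_zero (2 * k + 1)
  have key : evenTerm ν x (k + 1) =
      x ^ 2 * ((-ν + 2 * (k : ℂ)) / ((2 * k + 1) * (2 * k + 2))) * evenTerm ν x k := by
    have hf : (((2 * (k + 1)).factorial : ℕ) : ℂ) =
        (2 * k + 2) * ((2 * k + 1) * ((2 * k).factorial : ℂ)) := by
      rw [show 2 * (k + 1) = 2 * k + 1 + 1 by ring, Nat.factorial_succ, Nat.factorial_succ]
      push_cast; ring
    unfold evenTerm
    rw [hf, Finset.prod_range_succ]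
    field_simp
    ring
  rw [key, norm_mul, norm_mul]
  gcongr
  rw [norm_div]
  have hd : ‖((2 * (k : ℂ) + 1) * (2 * k + 2))‖ = (2 * (k : ℝ) + 1) * (2 * k + 2) := by
    have : ((2 * (k : ℂ) + 1) * (2 * k + 2)) = (((2 * k + 1) * (2 * k + 2) : ℕ) : ℂ) := by
      push_cast; ring
    rw [this, Complex.norm_natCast]; push_cast; ring
  rw [hd]
  gcongr
  refine (norm_add_le _ _).trans ?_
  simp

theorem summable_oddTerm (ν x : ℂ) : Summable (oddTerm ν x) := by
  refine summable_of_weber_ratio (-ν + 1) (x ^ 2) _ fun k => ?_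
  have h0 : (((2 * k + 1).factorial : ℕ) : ℂ) ≠ 0 := by exact_mod_cast Nat.factorial_ne_zero _
  have h1 : (2 * (k : ℂ) + 2) ≠ 0 := by exact_mod_cast Nat.succ_ne_zero (2 * k + 1)
  have h2 : (2 * (k : ℂ) + 3) ≠ 0 := by exact_mod_cast Nat.succ_ne_zero (2 * k + 2)
  have key : oddTerm ν x (k + 1) =
      x ^ 2 * ((-ν + 1 + 2 * (k : ℂ)) / ((2 * k + 2) * (2 * k + 3))) * oddTerm ν x k := by
    have hf : (((2 * (k + 1) + 1).factorial : ℕ) : ℂ) =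
        (2 * k + 3) * ((2 * k + 2) * ((2 * k + 1).factorial : ℂ)) := by
      rw [show 2 * (k + 1) + 1 = 2 * k + 1 + 1 + 1 by ring, Nat.factorial_succ,
        Nat.factorial_succ (2 * k + 1)]
      push_cast; ring
    unfold oddTerm
    rw [hf, Finset.prod_range_succ]
    field_simp
    ring
  rw [key, norm_mul, norm_mul]
  gcongr
  rw [norm_div]
  have hd : ‖((2 * (k : ℂ) + 2) * (2 * k + 3))‖ = (2 * (k : ℝ) + 2) * (2 * k + 3) := by
    have : ((2 * (k : ℂ) + 2) * (2 * k + 3)) = (((2 * k + 2) * (2 * k + 3) : ℕ) : ℂ) := by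
      push_cast; ring
    rw [this, Complex.norm_natCast]; push_cast; ring
  rw [hd]
  have hk0 : (0 : ℝ) ≤ k := Nat.cast_nonneg k
  have hn : ‖-ν + 1 + 2 * (k : ℂ)‖ ≤ ‖-ν + 1‖ + 2 * k := by
    refine (norm_add_le _ _).trans ?_
    simp
  refine div_le_div₀ (by positivity) hn (by positivity) ?_
  nlinarith

/-- The even solution `y_even(ν, x)` of the Weber equation
`-y'' + (x²/4 - 1/2) y = ν y`, with `y(0) = 1`, `y'(0) = 0`. -/
def yEven (ν x : ℂ) : ℂ :=
  Complex.exp (-x ^ 2 / 4) * ∑' k, evenTerm ν x k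

/-- The odd solution `y_odd(ν, x)` of the Weber equation
`-y'' + (x²/4 - 1/2) y = ν y`, with `y(0) = 0`, `y'(0) = 1`. -/
def yOdd (ν x : ℂ) : ℂ :=
  Complex.exp (-x ^ 2 / 4) * ∑' k, oddTerm ν x k

/-- The parabolic cylinder function `D_ν(x)`: the solution of the Weber equation with
`D_ν(0) = 2^{ν/2} √π / Γ(1/2 - ν/2)` and `D_ν'(0) = -2^{(ν+1)/2} √π / Γ(-ν/2)`.
Mathlib's `Complex.Gamma` is `0` at the poles of `Γ`, so `(Complex.Gamma s)⁻¹` is the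
entire function `1/Γ`. -/
def parabolicCylinderD (ν x : ℂ) : ℂ :=
  (2 : ℂ) ^ (ν / 2) * (Real.sqrt Real.pi : ℂ) * (Complex.Gamma (-ν / 2 + 1 / 2))⁻¹ * yEven ν x
    - (2 : ℂ) ^ ((ν + 1) / 2) * (Real.sqrt Real.pi : ℂ) * (Complex.Gamma (-ν / 2))⁻¹ * yOdd ν x

/-- `𝖣(ν) = D_ν(b)`. -/
def paramD (b : ℝ) (ν : ℂ) : ℂ := parabolicCylinderD ν b

/-- `Φ(ν) = √(2/π) y_even(ν, b) y_odd(ν, b)`. -/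
def paramPhi (b : ℝ) (ν : ℂ) : ℂ :=
  (Real.sqrt (2 / Real.pi) : ℂ) * yEven ν b * yOdd ν b

/-- `𝖬(ν) = Γ(-ν) 𝖣(ν)² Φ(ν)`, meaningful for `ν ∉ {0, 1, 2, …}`. -/
def paramM (b : ℝ) (ν : ℂ) : ℂ :=
  Complex.Gamma (-ν) * paramD b ν ^ 2 * paramPhi b ν

/-- The extension of `𝖬` to the point `n`, by the limit of `𝖬` there. -/
def paramMExt (b : ℝ) (n : ℕ) : ℂ → ℂ :=
  Function.update (paramM b) (n : ℂ) (limUnder (𝓝[≠] (n : ℂ)) (paramM b))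

end

/-! Write `E` and `O` for `weberEven` and `weberOdd`; both solve `y'' = x y' - ν y`, and their
Wronskian with weight `e^{-x²/2}` is 1. Lagrange's identity gives the parameter derivative of `E` or
`O` at a zero as plus or minus the other solution's value times `∫₀ᵇ` of the squared solution
(`hasDerivAt_weber_param`). At an integer `n` one of the two reciprocal Gamma factors of `D`
vanishes, so `D(n) = 0` forces `E(n, b) = 0` for even `n` and `O(n, b) = 0` for odd `n`; the other
solution is then nonzero at `b`. The zero of `Φ` is therefore simple, and its derivative has the
sign `(-1)^(n+1)`. For `D`, the derivative of the vanishing Gamma factor equals, up to a nonzero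
factor, the full norm over `(0, ∞)` (`inv_Gamma_mul_evenNorm`, `inv_Gamma_mul_oddNorm`). The
integral over `(0, b)` cancels, leaving a nonzero multiple of the tail over `(b, ∞)`, which is
positive. Finally `1/Γ(-ν)` has a simple zero at `n` with derivative `(-1)^(n+1) n!`. Three simple
zeros over one give order two, and the signs of `Φ'` and of `1/Γ` cancel in the leading coefficient.
-/

/-! ### Continuity of the power series and analyticity in the parameter. -/

/-- The power series `e^{x²/4} y_even(ν, x)`. -/
noncomputable def weberEven (ν x : ℂ) : ℂ := ∑' k, evenTerm ν x k

/-- The power series `e^{x²/4} y_odd(ν, x)`. -/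
noncomputable def weberOdd (ν x : ℂ) : ℂ := ∑' k, oddTerm ν x k

/-- At parameter `-R` and argument `R` all factors are nonnegative reals, so the majorant is again a
Weber series and its convergence is already known. -/
theorem norm_evenTerm_le {R : ℝ} {ν x : ℂ} (hν : ‖ν‖ ≤ R) (hx : ‖x‖ ≤ R) (k : ℕ) :
    ‖evenTerm ν x k‖ ≤ ‖evenTerm (-R) R k‖ := by
  have hR : 0 ≤ R := (norm_nonneg _).trans hν
  simp only [evenTerm, norm_div, norm_mul, norm_pow, norm_prod, Complex.norm_natCast]
  have h : ∀ j : ℕ, ‖-(-(R : ℂ)) + 2 * (j : ℂ)‖ = R + 2 * j := fun j => by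
    have : -(-(R : ℂ)) + 2 * (j : ℂ) = ((R + 2 * j : ℝ) : ℂ) := by push_cast; ring
    rw [this, Complex.norm_of_nonneg (by positivity)]
  simp only [h, Complex.norm_of_nonneg hR]
  gcongr with j _
  refine (norm_add_le _ _).trans ?_
  simpa using hν

theorem norm_oddTerm_le {R : ℝ} {ν x : ℂ} (hν : ‖ν‖ ≤ R) (hx : ‖x‖ ≤ R) (k : ℕ) :
    ‖oddTerm ν x k‖ ≤ ‖oddTerm (-R) R k‖ := by
  have hR : 0 ≤ R := (norm_nonneg _).trans hν
  simp only [oddTerm, norm_div, norm_mul, norm_pow, norm_prod, Complex.norm_natCast]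
  have h : ∀ j : ℕ, ‖-(-(R : ℂ)) + 1 + 2 * (j : ℂ)‖ = R + 1 + 2 * j := fun j => by
    have : -(-(R : ℂ)) + 1 + 2 * (j : ℂ) = ((R + 1 + 2 * j : ℝ) : ℂ) := by push_cast; ring
    rw [this, Complex.norm_of_nonneg (by positivity)]
  simp only [h, Complex.norm_of_nonneg hR]
  gcongr with j _
  refine (norm_add₃_le).trans ?_
  simpa using hν

/-- A series of continuous functions of two complex variables that is dominated on every
bidisc by a convergent one has a continuous sum. -/
theorem continuous_tsum_of_bidisc_bound {f : ℕ → ℂ × ℂ → ℂ} (u : ℝ → ℕ → ℝ)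
    (hc : ∀ k, Continuous (f k)) (hu : ∀ R, Summable (u R))
    (hb : ∀ R k (p : ℂ × ℂ), ‖p.1‖ ≤ R → ‖p.2‖ ≤ R → ‖f k p‖ ≤ u R k) :
    Continuous fun p => ∑' k, f k p := by
  rw [continuous_iff_continuousAt]
  intro p
  have h : ContinuousOn (fun p => ∑' k, f k p) (Metric.ball 0 (‖p‖ + 1)) := by
    refine continuousOn_tsum (fun k => (hc k).continuousOn) (hu (‖p‖ + 1)) fun k q hq => ?_
    have hq' : ‖q‖ ≤ ‖p‖ + 1 := (mem_ball_zero_iff.1 hq).le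
    exact hb _ k q ((norm_fst_le q).trans hq') ((norm_snd_le q).trans hq')
  exact h.continuousAt (Metric.isOpen_ball.mem_nhds (by simp))

theorem continuous_weberEven : Continuous fun p : ℂ × ℂ => weberEven p.1 p.2 :=
  continuous_tsum_of_bidisc_bound (fun R k => ‖evenTerm (-R) R k‖)
    (fun k => by unfold evenTerm; fun_prop) (fun R => (summable_evenTerm _ _).norm)
    fun _ k _ h1 h2 => norm_evenTerm_le h1 h2 k

theorem continuous_weberOdd : Continuous fun p : ℂ × ℂ => weberOdd p.1 p.2 :=
  continuous_tsum_of_bidisc_bound (fun R k => ‖oddTerm (-R) R k‖)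
    (fun k => by unfold oddTerm; fun_prop) (fun R => (summable_oddTerm _ _).norm)
    fun _ k _ h1 h2 => norm_oddTerm_le h1 h2 k

/-- A series of entire functions dominated on every disc by a convergent one has an entire sum,
which may be differentiated term by term. -/
theorem hasDerivAt_tsum_of_disc_bound {f f' : ℕ → ℂ → ℂ} (u : ℝ → ℕ → ℝ)
    (hf : ∀ k z, HasDerivAt (f k) (f' k z) z) (hu : ∀ R, Summable (u R))
    (hb : ∀ R k z, ‖z‖ ≤ R → ‖f k z‖ ≤ u R k) (z : ℂ) :
    HasDerivAt (fun w => ∑' k, f k w) (∑' k, f' k z) z := by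
  have hz : z ∈ Metric.ball (0 : ℂ) (‖z‖ + 1) := by simp
  have hle : ∀ k, ∀ w ∈ Metric.ball (0 : ℂ) (‖z‖ + 1), ‖f k w‖ ≤ u (‖z‖ + 1) k :=
    fun k w hw => hb _ k w (mem_ball_zero_iff.1 hw).le
  have hd : ∀ k, DifferentiableOn ℂ (f k) (Metric.ball 0 (‖z‖ + 1)) :=
    fun k w _ => (hf k w).differentiableAt.differentiableWithinAt
  have h1 := Complex.hasSum_deriv_of_summable_norm (hu _) hd Metric.isOpen_ball hle hz
  have h2 := (Complex.differentiableOn_tsum_of_summable_norm (hu _) hd Metric.isOpen_ball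
    hle).differentiableAt (Metric.isOpen_ball.mem_nhds hz)
  have h3 : ∑' k, f' k z = deriv (fun w => ∑' k, f k w) z := by
    rw [← h1.tsum_eq]
    exact tsum_congr fun k => (hf k z).deriv.symm
  rw [h3]
  exact h2.hasDerivAt

theorem differentiable_weberEven_param (x : ℂ) : Differentiable ℂ fun ν => weberEven ν x :=
  fun ν => (hasDerivAt_tsum_of_disc_bound
    (fun R k => ‖evenTerm (-(max R ‖x‖ : ℝ)) (max R ‖x‖ : ℝ) k‖)
    (fun k z => (show Differentiable ℂ fun ν => evenTerm ν x k by
      unfold evenTerm; fun_prop).differentiableAt.hasDerivAt)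
    (fun R => (summable_evenTerm _ _).norm)
    (fun _ k _ h => norm_evenTerm_le (h.trans (le_max_left _ _)) (le_max_right _ _) k)
    ν).differentiableAt

theorem differentiable_weberOdd_param (x : ℂ) : Differentiable ℂ fun ν => weberOdd ν x :=
  fun ν => (hasDerivAt_tsum_of_disc_bound
    (fun R k => ‖oddTerm (-(max R ‖x‖ : ℝ)) (max R ‖x‖ : ℝ) k‖)
    (fun k z => (show Differentiable ℂ fun ν => oddTerm ν x k by
      unfold oddTerm; fun_prop).differentiableAt.hasDerivAt)
    (fun R => (summable_oddTerm _ _).norm)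
    (fun _ k _ h => norm_oddTerm_le (h.trans (le_max_left _ _)) (le_max_right _ _) k)
    ν).differentiableAt

/-! ### Derivatives in `x`, contiguous relations and the Wronskian. -/

theorem factorial_succ_cast (k : ℕ) :
    ((k + 1).factorial : ℂ) = ((k : ℂ) + 1) * (k.factorial : ℂ) := by
  rw [Nat.factorial_succ]; push_cast; ring

/-- Splitting off the factor `j = 0`, which is `-ν`, shifts the parameter by one. Differentiating in
`x` cancels `x / (2k + 2)`. -/
theorem evenTerm_succ_eq (ν x : ℂ) (k : ℕ) :
    evenTerm ν x (k + 1) = -ν * oddTerm (ν - 1) x k * x / (2 * k + 2) := by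
  have h0 : (((2 * k + 1).factorial : ℕ) : ℂ) ≠ 0 := by exact_mod_cast Nat.factorial_ne_zero _
  have h2 : (2 * (k : ℂ) + 2) ≠ 0 := by exact_mod_cast Nat.succ_ne_zero (2 * k + 1)
  have hp : ∏ j ∈ Finset.range k, (-ν + 2 * ((j + 1 : ℕ) : ℂ)) =
      ∏ j ∈ Finset.range k, (-(ν - 1) + 1 + 2 * (j : ℂ)) :=
    Finset.prod_congr rfl fun j _ => by push_cast; ring
  unfold evenTerm oddTerm
  rw [Finset.prod_range_succ', hp, show 2 * (k + 1) = 2 * k + 1 + 1 by ring,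
    factorial_succ_cast (2 * k + 1)]
  push_cast
  rw [show (2 * (k : ℂ) + 1 + 1) = 2 * k + 2 by ring]
  field_simp
  ring

theorem oddTerm_eq (ν x : ℂ) (k : ℕ) :
    oddTerm ν x k = evenTerm (ν - 1) x k * x / (2 * k + 1) := by
  have h0 : (((2 * k).factorial : ℕ) : ℂ) ≠ 0 := by exact_mod_cast Nat.factorial_ne_zero _
  have h1 : (2 * (k : ℂ) + 1) ≠ 0 := by exact_mod_cast Nat.succ_ne_zero (2 * k)
  have hp : ∏ j ∈ Finset.range k, (-ν + 1 + 2 * (j : ℂ)) =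
      ∏ j ∈ Finset.range k, (-(ν - 1) + 2 * (j : ℂ)) :=
    Finset.prod_congr rfl fun j _ => by ring
  unfold evenTerm oddTerm
  rw [hp, factorial_succ_cast (2 * k)]
  push_cast
  field_simp
  ring

theorem evenTerm_zero (ν x : ℂ) : evenTerm ν x 0 = 1 := by simp [evenTerm]

theorem weberEven_eq (ν x : ℂ) : weberEven ν x = 1 + ∑' k, evenTerm ν x (k + 1) := by
  rw [weberEven, (summable_evenTerm ν x).tsum_eq_zero_add, evenTerm_zero]

theorem hasDerivAt_weberEven (ν x : ℂ) :
    HasDerivAt (weberEven ν) (-ν * weberOdd (ν - 1) x) x := by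
  have h := (hasDerivAt_tsum_of_disc_bound (f := fun k x => evenTerm ν x (k + 1))
    (f' := fun k x => -ν * oddTerm (ν - 1) x k)
    (fun R k => ‖evenTerm (-(max R ‖ν‖ : ℝ)) (max R ‖ν‖ : ℝ) (k + 1)‖)
    (fun k z => ?_)
    (fun R => (summable_nat_add_iff 1).2 (summable_evenTerm _ _).norm)
    (fun _ k _ h => norm_evenTerm_le (le_max_right _ _) (h.trans (le_max_left _ _)) _)
    x).const_add 1
  · rw [tsum_mul_left] at h
    exact h.congr_of_eventuallyEq (Eventually.of_forall fun y => weberEven_eq ν y)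
  · have h2 : (2 * (k : ℂ) + 2) ≠ 0 := by exact_mod_cast Nat.succ_ne_zero (2 * k + 1)
    have : (fun x => evenTerm ν x (k + 1)) = fun x => (-ν * (∏ j ∈ Finset.range k,
        (-(ν - 1) + 1 + 2 * (j : ℂ))) / ((2 * k + 1).factorial : ℂ) / (2 * k + 2)) *
          x ^ (2 * k + 2) := by
      funext x
      rw [evenTerm_succ_eq, oddTerm]
      ring
    rw [this]
    refine ((hasDerivAt_pow (2 * k + 2) z).const_mul _).congr_deriv ?_
    rw [oddTerm]
    push_cast
    field_simp

theorem hasDerivAt_weberOdd (ν x : ℂ) :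
    HasDerivAt (weberOdd ν) (weberEven (ν - 1) x) x := by
  refine hasDerivAt_tsum_of_disc_bound (f := fun k x => oddTerm ν x k)
    (f' := fun k x => evenTerm (ν - 1) x k)
    (fun R k => ‖oddTerm (-(max R ‖ν‖ : ℝ)) (max R ‖ν‖ : ℝ) k‖)
    (fun k z => ?_)
    (fun R => (summable_oddTerm _ _).norm)
    (fun _ k _ h => norm_oddTerm_le (le_max_right _ _) (h.trans (le_max_left _ _)) _) x
  have h1 : (2 * (k : ℂ) + 1) ≠ 0 := by exact_mod_cast Nat.succ_ne_zero (2 * k)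
  have : (fun x => oddTerm ν x k) = fun x => ((∏ j ∈ Finset.range k,
      (-(ν - 1) + 2 * (j : ℂ))) / ((2 * k).factorial : ℂ) / (2 * k + 1)) *
        x ^ (2 * k + 1) := by
    funext x
    rw [oddTerm_eq, evenTerm]
    ring
  rw [this]
  refine ((hasDerivAt_pow (2 * k + 1) z).const_mul _).congr_deriv ?_
  rw [evenTerm]
  push_cast
  field_simp

theorem weberEven_zero (ν : ℂ) : weberEven ν 0 = 1 := by
  rw [weberEven_eq]
  simp [evenTerm]

theorem weberOdd_zero (ν : ℂ) : weberOdd ν 0 = 0 := by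
  simp [weberOdd, oddTerm]

/-- Two differentiations lower the parameter by 2; this relation brings it back, and so carries the
differential equation. -/
theorem weberEven_contiguous (ν x : ℂ) :
    weberEven (ν - 2) x = x * weberOdd (ν - 1) x + weberEven ν x := by
  have hs := (summable_nat_add_iff 1).2 (summable_evenTerm ν x)
  have ho := (summable_oddTerm (ν - 1) x).mul_left x
  rw [weberEven_eq, weberEven_eq ν, weberOdd, ← tsum_mul_left,
    add_left_comm, ← ho.tsum_add hs]
  congr 1
  refine tsum_congr fun k => ?_
  have h2 : (2 * (k : ℂ) + 2) ≠ 0 := by exact_mod_cast Nat.succ_ne_zero (2 * k + 1)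
  have h0 : (((2 * k + 1).factorial : ℕ) : ℂ) ≠ 0 := by exact_mod_cast Nat.factorial_ne_zero _
  rw [evenTerm_succ_eq ν, evenTerm, oddTerm, Finset.prod_range_succ,
    show 2 * (k + 1) = 2 * k + 1 + 1 by ring, factorial_succ_cast (2 * k + 1)]
  have hp : ∏ j ∈ Finset.range k, (-(ν - 2) + 2 * (j : ℂ)) =
      ∏ j ∈ Finset.range k, (-(ν - 1) + 1 + 2 * (j : ℂ)) :=
    Finset.prod_congr rfl fun j _ => by ring
  rw [hp]
  push_cast
  rw [show (2 * (k : ℂ) + 1 + 1) = 2 * k + 2 by ring]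
  field_simp
  ring

theorem weberOdd_contiguous (ν x : ℂ) :
    (1 - ν) * weberOdd (ν - 2) x = x * weberEven (ν - 1) x - ν * weberOdd ν x := by
  have he := (summable_evenTerm (ν - 1) x).mul_left x
  have ho := (summable_oddTerm ν x).mul_left ν
  rw [weberOdd, weberOdd, weberEven, ← tsum_mul_left, ← tsum_mul_left, ← tsum_mul_left,
    ← he.tsum_sub ho]
  refine tsum_congr fun k => ?_
  have h1 : (2 * (k : ℂ) + 1) ≠ 0 := by exact_mod_cast Nat.succ_ne_zero (2 * k)
  have h0 : (((2 * k).factorial : ℕ) : ℂ) ≠ 0 := by exact_mod_cast Nat.factorial_ne_zero _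
  -- The prefactor `1 - ν` supplies the missing first factor: both sides are the product of `1 - ν +
  -- 2j` over `j ≤ k`.
  have hp : (1 - ν) * ∏ j ∈ Finset.range k, (-(ν - 2) + 1 + 2 * (j : ℂ)) =
      (∏ j ∈ Finset.range k, (-(ν - 1) + 2 * (j : ℂ))) * (1 - ν + 2 * k) := by
    have hl := Finset.prod_range_succ' (fun j : ℕ => (1 - ν) + 2 * (j : ℂ)) k
    rw [Finset.prod_range_succ] at hl
    have e1 : ∏ j ∈ Finset.range k, (-(ν - 2) + 1 + 2 * (j : ℂ)) =
        ∏ j ∈ Finset.range k, ((1 - ν) + 2 * ((j + 1 : ℕ) : ℂ)) :=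
      Finset.prod_congr rfl fun j _ => by push_cast; ring
    have e2 : ∏ j ∈ Finset.range k, (-(ν - 1) + 2 * (j : ℂ)) =
        ∏ j ∈ Finset.range k, ((1 - ν) + 2 * (j : ℂ)) :=
      Finset.prod_congr rfl fun j _ => by ring
    rw [e1, e2, hl]
    push_cast
    ring
  rw [oddTerm_eq ν, oddTerm, evenTerm, ← mul_div_assoc, ← mul_assoc, hp, factorial_succ_cast]
  push_cast
  field_simp
  ring

theorem hasDerivAt_weberEven_deriv (ν x : ℂ) :
    HasDerivAt (fun x => -ν * weberOdd (ν - 1) x)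
      (x * (-ν * weberOdd (ν - 1) x) - ν * weberEven ν x) x := by
  refine HasDerivAt.congr_deriv ((hasDerivAt_weberOdd (ν - 1) x).const_mul (-ν)) ?_
  rw [show ν - 1 - 1 = ν - 2 by ring, weberEven_contiguous]
  ring

theorem hasDerivAt_weberOdd_deriv (ν x : ℂ) :
    HasDerivAt (fun x => weberEven (ν - 1) x)
      (x * weberEven (ν - 1) x - ν * weberOdd ν x) x := by
  refine HasDerivAt.congr_deriv (hasDerivAt_weberEven (ν - 1) x) ?_
  rw [show ν - 1 - 1 = ν - 2 by ring, neg_sub, weberOdd_contiguous]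

theorem hasDerivAt_gaussian (x : ℂ) :
    HasDerivAt (fun x : ℂ => Complex.exp (-x ^ 2 / 2)) (-x * Complex.exp (-x ^ 2 / 2)) x := by
  refine HasDerivAt.congr_deriv ((((hasDerivAt_pow 2 x).neg.div_const 2).cexp)) ?_
  simp only [Pi.neg_apply]
  push_cast
  ring

/-- The Wronskian of the even and the odd solution is `1`. -/
theorem weber_wronskian (ν x : ℂ) :
    (weberEven ν x * weberEven (ν - 1) x + ν * weberOdd (ν - 1) x * weberOdd ν x) *
      Complex.exp (-x ^ 2 / 2) = 1 := by
  -- Abel's identity: the unweighted Wronskian satisfies `W' = x W`, which the Gaussian weight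
  -- compensates.
  have hd : ∀ x, HasDerivAt (fun x => (weberEven ν x * weberEven (ν - 1) x -
      -ν * weberOdd (ν - 1) x * weberOdd ν x) * Complex.exp (-x ^ 2 / 2)) 0 x := fun x => by
    refine HasDerivAt.congr_deriv ((((hasDerivAt_weberEven ν x).mul (hasDerivAt_weberOdd_deriv ν x)).sub
      ((hasDerivAt_weberEven_deriv ν x).mul (hasDerivAt_weberOdd ν x))).mul
        (hasDerivAt_gaussian x)) ?_
    simp only [Pi.mul_apply, Pi.sub_apply]
    ring
  have h := is_const_of_deriv_eq_zero (fun x => (hd x).differentiableAt)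
    (fun x => (hd x).deriv) x 0
  simp only [weberEven_zero, weberOdd_zero] at h
  simpa using h

/-! ### Lagrange's identity and parameter derivatives at a zero. -/

section Lagrange

variable {F F₁ : ℂ → ℂ → ℂ}

/-- Lagrange's identity for two solutions of `F'' = x F' - ν F` with different parameters. -/
theorem weber_lagrange (hF : ∀ ν x, HasDerivAt (F ν) (F₁ ν x) x)
    (hF₁ : ∀ ν x, HasDerivAt (F₁ ν) (x * F₁ ν x - ν * F ν x) x)
    (h0 : ∀ ν μ, F ν 0 * F₁ μ 0 = F₁ ν 0 * F μ 0) (ν μ : ℂ) (b : ℝ) :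
    (F ν b * F₁ μ b - F₁ ν b * F μ b) * Complex.exp (-(b : ℂ) ^ 2 / 2) =
      (ν - μ) * ∫ x : ℝ in 0..b, F ν x * F μ x * Complex.exp (-(x : ℂ) ^ 2 / 2) := by
  have hd : ∀ x : ℝ, HasDerivAt (fun x : ℝ => (F ν x * F₁ μ x - F₁ ν x * F μ x) *
      Complex.exp (-(x : ℂ) ^ 2 / 2))
      ((ν - μ) * (F ν x * F μ x * Complex.exp (-(x : ℂ) ^ 2 / 2))) x := fun x => by
    refine HasDerivAt.comp_ofReal (e := fun x : ℂ => (F ν x * F₁ μ x - F₁ ν x * F μ x) *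
      Complex.exp (-x ^ 2 / 2)) ?_
    refine HasDerivAt.congr_deriv ((((hF ν x).mul (hF₁ μ x)).sub ((hF₁ ν x).mul (hF μ x))).mul
      (hasDerivAt_gaussian x)) ?_
    simp only [Pi.mul_apply, Pi.sub_apply]
    ring
  have hcont : ∀ ν, Continuous (F ν) := fun ν =>
    continuous_iff_continuousAt.2 fun x => (hF ν x).continuousAt
  have hint : Continuous fun x : ℝ => (ν - μ) * (F ν x * F μ x *
      Complex.exp (-(x : ℂ) ^ 2 / 2)) := by
    have := hcont ν
    have := hcont μ
    fun_prop
  have h := intervalIntegral.integral_eq_sub_of_hasDerivAt (fun x _ => hd x)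
    (hint.intervalIntegrable 0 b)
  rw [intervalIntegral.integral_const_mul] at h
  rw [h]
  -- By `h0` the boundary term at 0 vanishes.
  simp [h0]

/-- Away from `μ` the slope is `g` itself, so continuity of the Lagrange integral suffices and
nothing is differentiated under the integral sign. -/
theorem hasDerivAt_of_eq_sub_mul {f g : ℂ → ℂ} {μ : ℂ} (h : ∀ ν, f ν = (ν - μ) * g ν)
    (hg : Continuous g) : HasDerivAt f (g μ) μ := by
  rw [hasDerivAt_iff_tendsto_slope]
  refine (hg.continuousAt.tendsto.mono_left nhdsWithin_le_nhds).congr' ?_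
  filter_upwards [self_mem_nhdsWithin] with ν hν
  have : ν - μ ≠ 0 := sub_ne_zero.2 hν
  rw [slope_def_field, h, h μ]
  field_simp
  ring

/-- The derivative in the parameter at a zero of the solution. -/
theorem hasDerivAt_weber_param (hF : ∀ ν x, HasDerivAt (F ν) (F₁ ν x) x)
    (hF₁ : ∀ ν x, HasDerivAt (F₁ ν) (x * F₁ ν x - ν * F ν x) x)
    (h0 : ∀ ν μ, F ν 0 * F₁ μ 0 = F₁ ν 0 * F μ 0)
    (hc : Continuous fun p : ℂ × ℂ => F p.1 p.2) {μ c : ℂ} {b : ℝ} (hb : F μ b = 0)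
    (hw : c * F₁ μ b * Complex.exp (-(b : ℂ) ^ 2 / 2) = 1) :
    HasDerivAt (fun ν => F ν b)
      (c * ∫ x : ℝ in 0..b, F μ x ^ 2 * Complex.exp (-(x : ℂ) ^ 2 / 2)) μ := by
  have hI : Continuous fun ν => c * ∫ x : ℝ in 0..b, F ν x * F μ x *
      Complex.exp (-(x : ℂ) ^ 2 / 2) := by
    refine continuous_const.mul
      (intervalIntegral.continuous_parametric_intervalIntegral_of_continuous' ?_ 0 b)
    have h1 : Continuous fun p : ℂ × ℝ => F p.1 p.2 :=
      hc.comp (continuous_fst.prodMk (Complex.continuous_ofReal.comp continuous_snd))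
    have h2 : Continuous fun p : ℂ × ℝ => F μ p.2 :=
      hc.comp (continuous_const.prodMk (Complex.continuous_ofReal.comp continuous_snd))
    exact (h1.mul h2).mul (by fun_prop)
  have h := hasDerivAt_of_eq_sub_mul (f := fun ν => F ν b) (μ := μ) (fun ν => ?_) hI
  · simpa only [pow_two] using h
  · have := weber_lagrange hF hF₁ h0 ν μ b
    rw [hb] at this
    linear_combination c * this - F ν b * hw

end Lagrange

/-- At a zero only one product survives in the Wronskian, which identifies the constant `c` as
`-weberOdd μ b`. -/
theorem hasDerivAt_weberEven_param {μ : ℂ} {b : ℝ} (hb : weberEven μ b = 0) :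
    HasDerivAt (fun ν => weberEven ν b) (-weberOdd μ b *
      ∫ x : ℝ in 0..b, weberEven μ x ^ 2 * Complex.exp (-(x : ℂ) ^ 2 / 2)) μ := by
  refine hasDerivAt_weber_param hasDerivAt_weberEven hasDerivAt_weberEven_deriv
    (fun ν μ => by simp [weberOdd_zero]) continuous_weberEven hb ?_
  have := weber_wronskian μ b
  rw [hb] at this
  linear_combination this

theorem hasDerivAt_weberOdd_param {μ : ℂ} {b : ℝ} (hb : weberOdd μ b = 0) :
    HasDerivAt (fun ν => weberOdd ν b) (weberEven μ b *
      ∫ x : ℝ in 0..b, weberOdd μ x ^ 2 * Complex.exp (-(x : ℂ) ^ 2 / 2)) μ := by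
  refine hasDerivAt_weber_param hasDerivAt_weberOdd hasDerivAt_weberOdd_deriv
    (fun ν μ => by simp [weberOdd_zero]) continuous_weberOdd hb ?_
  have := weber_wronskian μ b
  rw [hb] at this
  linear_combination this

/-! ### Polynomials times a Gaussian, and the terminating series. -/

theorem integrable_polynomial_mul_gaussian (p : Polynomial ℝ) :
    MeasureTheory.Integrable fun x : ℝ => p.eval x * Real.exp (-x ^ 2 / 2) := by
  induction p using Polynomial.induction_on' with
  | add p q hp hq =>
    simp only [Polynomial.eval_add, add_mul]
    exact hp.add hq
  | monomial n a =>
    have h := (integrable_rpow_mul_exp_neg_mul_sq (b := 1 / 2) (by norm_num) (s := n)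
      (by linarith [n.cast_nonneg (α := ℝ)])).const_mul a
    refine h.congr (Eventually.of_forall fun x => ?_)
    simp only [Polynomial.eval_monomial, Real.rpow_natCast, mul_assoc]
    congr 3
    ring

theorem tendsto_polynomial_mul_gaussian (p : Polynomial ℝ) :
    Tendsto (fun x : ℝ => p.eval x * Real.exp (-x ^ 2 / 2)) atTop (𝓝 0) := by
  induction p using Polynomial.induction_on' with
  | add p q hp hq => simpa only [Polynomial.eval_add, add_mul, add_zero] using hp.add hq
  | monomial n a =>
    have h := ((tendsto_rpow_abs_mul_exp_neg_mul_sq_cocompact (a := 1 / 2) (by norm_num)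
      n).mono_left atTop_le_cocompact).const_mul a
    rw [mul_zero] at h
    refine h.congr' ?_
    filter_upwards [eventually_ge_atTop 0] with x hx
    simp only [Polynomial.eval_monomial, Real.rpow_natCast, mul_assoc, abs_of_nonneg hx]
    congr 3
    ring

/-- The complex-valued function `f` is a real polynomial times `e^{-x²/2}`. -/
def IsPolynomialGaussian (f : ℝ → ℂ) : Prop :=
  ∃ p : Polynomial ℝ, f = fun x : ℝ => ((p.eval x * Real.exp (-x ^ 2 / 2) : ℝ) : ℂ)

theorem IsPolynomialGaussian.integrable {f : ℝ → ℂ} (hf : IsPolynomialGaussian f) :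
    MeasureTheory.Integrable f := by
  obtain ⟨p, rfl⟩ := hf
  exact (integrable_polynomial_mul_gaussian p).ofReal

theorem IsPolynomialGaussian.tendsto {f : ℝ → ℂ} (hf : IsPolynomialGaussian f) :
    Tendsto f atTop (𝓝 0) := by
  obtain ⟨p, rfl⟩ := hf
  exact_mod_cast (Complex.continuous_ofReal.tendsto 0).comp (tendsto_polynomial_mul_gaussian p)

theorem isPolynomialGaussian_mul {f g : ℝ → ℂ} {p q : Polynomial ℝ}
    (hf : ∀ x, f x = (p.eval x : ℝ)) (hg : ∀ x, g x = (q.eval x : ℝ)) :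
    IsPolynomialGaussian fun x => f x * g x * Complex.exp (-(x : ℂ) ^ 2 / 2) :=
  ⟨p * q, by funext x; simp [hf, hg]⟩

/-- The factor `j = m` vanishes, so the series stops after `k = m`: a Hermite polynomial up to
scaling. -/
theorem exists_polynomial_weberEven (m : ℕ) :
    ∃ p : Polynomial ℝ, ∀ x : ℝ, weberEven (2 * m) x = (p.eval x : ℝ) := by
  refine ⟨∑ k ∈ Finset.range (m + 1), Polynomial.C
    ((∏ j ∈ Finset.range k, (-(2 * m) + 2 * (j : ℝ))) / ((2 * k).factorial : ℝ)) *
      Polynomial.X ^ (2 * k), fun x => ?_⟩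
  rw [weberEven, tsum_eq_sum (s := Finset.range (m + 1)), Polynomial.eval_finsetSum]
  · push_cast
    refine Finset.sum_congr rfl fun k _ => ?_
    simp only [evenTerm, Polynomial.eval_mul, Polynomial.eval_C, Polynomial.eval_pow,
      Polynomial.eval_X]
    push_cast
    ring
  · intro k hk
    have : ∏ j ∈ Finset.range k, (-(2 * m : ℂ) + 2 * (j : ℂ)) = 0 :=
      Finset.prod_eq_zero (i := m) (by simp at hk ⊢; omega) (by ring)
    simp [evenTerm, this]

theorem exists_polynomial_weberOdd (m : ℕ) :
    ∃ p : Polynomial ℝ, ∀ x : ℝ, weberOdd (2 * m + 1) x = (p.eval x : ℝ) := by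
  refine ⟨∑ k ∈ Finset.range (m + 1), Polynomial.C
    ((∏ j ∈ Finset.range k, (-(2 * m + 1) + 1 + 2 * (j : ℝ))) / ((2 * k + 1).factorial : ℝ)) *
      Polynomial.X ^ (2 * k + 1), fun x => ?_⟩
  rw [weberOdd, tsum_eq_sum (s := Finset.range (m + 1)), Polynomial.eval_finsetSum]
  · push_cast
    refine Finset.sum_congr rfl fun k _ => ?_
    simp only [oddTerm, Polynomial.eval_mul, Polynomial.eval_C, Polynomial.eval_pow,
      Polynomial.eval_X]
    push_cast
    ring
  · intro k hk
    have : ∏ j ∈ Finset.range k, (-(2 * m + 1 : ℂ) + 1 + 2 * (j : ℂ)) = 0 :=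
      Finset.prod_eq_zero (i := m) (by simp at hk ⊢; omega) (by ring)
    rw [oddTerm, this, zero_mul, zero_div]

/-! ### Norms over the half-line, tails and reciprocal Gamma values. -/

/-- `∫₀^∞ y_even(ν, x)² dx`. -/
noncomputable def evenNorm (ν : ℂ) : ℂ :=
  ∫ x : ℝ in Set.Ioi 0, weberEven ν x * weberEven ν x * Complex.exp (-(x : ℂ) ^ 2 / 2)

/-- `∫₀^∞ y_odd(ν, x)² dx`. -/
noncomputable def oddNorm (ν : ℂ) : ℂ :=
  ∫ x : ℝ in Set.Ioi 0, weberOdd ν x * weberOdd ν x * Complex.exp (-(x : ℂ) ^ 2 / 2)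

/-- The difference of the two integrands is the derivative of `E_ν O_{ν-1} e^{-x²/2}`, which
vanishes at 0 and at infinity. -/
theorem evenNorm_eq {ν : ℂ} {p q : Polynomial ℝ} (hp : ∀ x : ℝ, weberEven ν x = (p.eval x : ℝ))
    (hq : ∀ x : ℝ, weberOdd (ν - 1) x = (q.eval x : ℝ)) :
    evenNorm ν = ν * oddNorm (ν - 1) := by
  have h1 := (isPolynomialGaussian_mul hp hp).integrable
  have h2 := (isPolynomialGaussian_mul hq hq).integrable
  have h := MeasureTheory.integral_Ioi_of_hasDerivAt_of_tendsto' (a := 0)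
    (f := fun x : ℝ => weberEven ν x * weberOdd (ν - 1) x * Complex.exp (-(x : ℂ) ^ 2 / 2))
    (f' := fun x : ℝ => weberEven ν x * weberEven ν x * Complex.exp (-(x : ℂ) ^ 2 / 2) -
      ν * (weberOdd (ν - 1) x * weberOdd (ν - 1) x * Complex.exp (-(x : ℂ) ^ 2 / 2)))
    (fun x _ => HasDerivAt.comp_ofReal (e := fun x : ℂ => weberEven ν x * weberOdd (ν - 1) x *
      Complex.exp (-x ^ 2 / 2)) (HasDerivAt.congr_deriv
        (((hasDerivAt_weberEven ν x).mul (hasDerivAt_weberOdd (ν - 1) x)).mul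
          (hasDerivAt_gaussian x)) ?_))
    (h1.sub (h2.const_mul ν)).integrableOn (isPolynomialGaussian_mul hp hq).tendsto
  · rw [MeasureTheory.integral_sub h1.integrableOn (h2.const_mul ν).integrableOn,
      MeasureTheory.integral_const_mul] at h
    simp only [Complex.ofReal_zero, weberOdd_zero, mul_zero, zero_mul, sub_zero] at h
    exact sub_eq_zero.1 h
  · rw [show ν - 1 - 1 = ν - 2 by ring, weberEven_contiguous]
    simp only [Pi.mul_apply]
    ring

/-- Same argument with the primitive `O_ν E_{ν-1} e^{-x²/2}`. -/
theorem evenNorm_sub_one_eq {ν : ℂ} {p q : Polynomial ℝ}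
    (hp : ∀ x : ℝ, weberEven (ν - 1) x = (p.eval x : ℝ))
    (hq : ∀ x : ℝ, weberOdd ν x = (q.eval x : ℝ)) :
    evenNorm (ν - 1) = ν * oddNorm ν := by
  have h1 := (isPolynomialGaussian_mul hp hp).integrable
  have h2 := (isPolynomialGaussian_mul hq hq).integrable
  have h := MeasureTheory.integral_Ioi_of_hasDerivAt_of_tendsto' (a := 0)
    (f := fun x : ℝ => weberOdd ν x * weberEven (ν - 1) x * Complex.exp (-(x : ℂ) ^ 2 / 2))
    (f' := fun x : ℝ => weberEven (ν - 1) x * weberEven (ν - 1) x *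
      Complex.exp (-(x : ℂ) ^ 2 / 2) -
      ν * (weberOdd ν x * weberOdd ν x * Complex.exp (-(x : ℂ) ^ 2 / 2)))
    (fun x _ => HasDerivAt.comp_ofReal (e := fun x : ℂ => weberOdd ν x * weberEven (ν - 1) x *
      Complex.exp (-x ^ 2 / 2)) (HasDerivAt.congr_deriv
        (((hasDerivAt_weberOdd ν x).mul (hasDerivAt_weberOdd_deriv ν x)).mul
          (hasDerivAt_gaussian x)) ?_))
    (h1.sub (h2.const_mul ν)).integrableOn (isPolynomialGaussian_mul hq hp).tendsto
  · rw [MeasureTheory.integral_sub h1.integrableOn (h2.const_mul ν).integrableOn,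
      MeasureTheory.integral_const_mul] at h
    simp only [Complex.ofReal_zero, weberOdd_zero, zero_mul, sub_zero] at h
    exact sub_eq_zero.1 h
  · simp only [Pi.mul_apply]
    ring

theorem evenNorm_eq_mul_oddNorm (m : ℕ) :
    evenNorm (2 * m) = (2 * m + 1) * oddNorm (2 * m + 1) := by
  obtain ⟨p, hp⟩ := exists_polynomial_weberEven m
  obtain ⟨q, hq⟩ := exists_polynomial_weberOdd m
  have h := evenNorm_sub_one_eq (ν := 2 * m + 1) (p := p) (by simpa using hp) hq
  rwa [add_sub_cancel_right] at h

theorem evenNorm_succ_eq_mul_oddNorm (m : ℕ) :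
    evenNorm (2 * (m + 1 : ℕ)) = (2 * m + 2) * oddNorm (2 * m + 1) := by
  obtain ⟨p, hp⟩ := exists_polynomial_weberEven (m + 1)
  obtain ⟨q, hq⟩ := exists_polynomial_weberOdd m
  have e : (2 * ((m + 1 : ℕ) : ℂ)) - 1 = 2 * m + 1 := by push_cast; ring
  have h := evenNorm_eq hp (q := q) (by simpa only [e] using hq)
  rw [h, e]
  push_cast
  ring

theorem evenNorm_zero : evenNorm 0 = (Real.sqrt (Real.pi / 2) : ℂ) := by
  have h0 : ∀ x, weberEven 0 x = 1 := fun x => by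
    rw [weberEven_eq, tsum_congr (g := fun _ => 0) fun k => by simp [evenTerm_succ_eq]]
    simp
  have h : ∀ x : ℝ, (1 : ℂ) * 1 * Complex.exp (-(x : ℂ) ^ 2 / 2) =
      ((Real.exp (-(1 / 2) * x ^ 2) : ℝ) : ℂ) := fun x => by
    push_cast
    rw [one_mul, one_mul]
    congr 1
    ring
  simp only [evenNorm, h0, h]
  rw [integral_complex_ofReal, integral_gaussian_Ioi, show Real.pi / (1 / 2) =
    2 ^ 2 * (Real.pi / 2) by ring, Real.sqrt_mul (by norm_num), Real.sqrt_sq (by norm_num)]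
  congr 1
  ring

/-- The integrand is nonnegative and vanishes only on the finite root set. -/
theorem integral_Ioi_polynomial_sq_pos {p : Polynomial ℝ} (hp : p ≠ 0) (b : ℝ) :
    0 < ∫ x in Set.Ioi b, (p * p).eval x * Real.exp (-x ^ 2 / 2) := by
  have h0 : ∀ x, 0 ≤ (p * p).eval x * Real.exp (-x ^ 2 / 2) := fun x => by
    rw [Polynomial.eval_mul]
    exact mul_nonneg (mul_self_nonneg _) (Real.exp_pos _).le
  rw [MeasureTheory.setIntegral_pos_iff_support_of_nonneg_ae (Eventually.of_forall h0)
    (integrable_polynomial_mul_gaussian _).integrableOn]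
  have hs : Set.Ioi b \ (p.rootSet ℝ) ⊆
      Function.support (fun x => (p * p).eval x * Real.exp (-x ^ 2 / 2)) ∩ Set.Ioi b := by
    intro x hx
    refine ⟨?_, hx.1⟩
    have : p.eval x ≠ 0 := fun h => hx.2 (by simp [Polynomial.mem_rootSet, hp, h])
    simp [Polynomial.eval_mul, this, (Real.exp_pos _).ne']
  refine lt_of_lt_of_le ?_ (MeasureTheory.measure_mono hs)
  rw [MeasureTheory.measure_sdiff_null ((p.rootSet_finite ℝ).measure_zero _)]
  simp

/-- The part of the norm integral over `(b, ∞)` is positive. -/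
theorem exists_norm_tail {f : ℝ → ℂ} {p : Polynomial ℝ} (hp : p ≠ 0)
    (hf : ∀ x, f x = (p.eval x : ℝ)) {b : ℝ} (hb : 0 < b) :
    ∃ I T : ℝ, 0 < I ∧ 0 < T ∧
      (∫ x : ℝ in 0..b, f x ^ 2 * Complex.exp (-(x : ℂ) ^ 2 / 2)) = I ∧
      (∫ x : ℝ in Set.Ioi 0, f x * f x * Complex.exp (-(x : ℂ) ^ 2 / 2)) = I + T := by
  set g : ℝ → ℝ := fun x => (p * p).eval x * Real.exp (-x ^ 2 / 2) with hg
  have hgi := integrable_polynomial_mul_gaussian (p * p)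
  have e : ∀ x, f x * f x * Complex.exp (-(x : ℂ) ^ 2 / 2) = (g x : ℂ) := fun x => by
    simp [hg, hf]
  have hc : Continuous g := by fun_prop
  have hsplit : (∫ x in (0 : ℝ)..b, g x) + ∫ x in Set.Ioi b, g x = ∫ x in Set.Ioi 0, g x :=
    intervalIntegral.integral_interval_add_Ioi hgi.integrableOn hgi.integrableOn
  refine ⟨∫ x in (0 : ℝ)..b, g x, ∫ x in Set.Ioi b, g x, ?_,
    integral_Ioi_polynomial_sq_pos hp b, ?_, ?_⟩
  · refine intervalIntegral.integral_pos hb hc.continuousOn (fun x _ => ?_) ?_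
    · simp only [hg, Polynomial.eval_mul]
      exact mul_nonneg (mul_self_nonneg _) (Real.exp_pos _).le
    · by_contra! h
      refine hp (p.eq_zero_of_infinite_isRoot ((Set.Icc_infinite hb).mono fun x hx => ?_))
      have h1 := h x hx
      simp only [hg, Polynomial.eval_mul] at h1
      have h2 := le_of_mul_le_mul_right (h1.trans_eq (zero_mul _).symm) (Real.exp_pos _)
      exact mul_self_eq_zero.1 (le_antisymm h2 (mul_self_nonneg _))
  · simp only [pow_two (f _), e]
    exact intervalIntegral.integral_ofReal
  · simp only [e]
    rw [integral_complex_ofReal, ← hsplit]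
    push_cast
    rfl

/-- Induction through `1/Γ(s) = s · 1/Γ(s+1)`: in the product rule the term with the
undifferentiated `1/Γ(-m) = 0` drops out. -/
theorem hasDerivAt_inv_Gamma_neg_nat (m : ℕ) :
    HasDerivAt (fun s => (Complex.Gamma s)⁻¹) ((-1) ^ m * (m.factorial : ℂ)) (-(m : ℂ)) := by
  have hmul : (fun s => (Complex.Gamma s)⁻¹) = fun s => s * (Complex.Gamma (s + 1))⁻¹ :=
    funext Complex.one_div_Gamma_eq_self_mul_one_div_Gamma_add_one
  induction m with
  | zero =>
    rw [hmul]
    have h := (Complex.differentiable_one_div_Gamma (0 + 1)).hasDerivAt.comp_add_const 0 1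
    rw [Nat.cast_zero, neg_zero]
    refine ((hasDerivAt_id (0 : ℂ)).mul h).congr_deriv ?_
    simp [Complex.Gamma_one]
  | succ m ih =>
    rw [hmul]
    have e : -((m + 1 : ℕ) : ℂ) + 1 = -(m : ℂ) := by push_cast; ring
    rw [← e] at ih
    have h := (hasDerivAt_id (-((m + 1 : ℕ) : ℂ))).mul (ih.comp_add_const _ 1)
    refine h.congr_deriv ?_
    rw [e, Complex.Gamma_neg_nat_eq_zero, factorial_succ_cast]
    simp only [id]
    push_cast
    ring

theorem two_sqrt_half_pi : (2 : ℝ) * (√(Real.pi / 2)) = √2 * √Real.pi := by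
  rw [Real.sqrt_div' _ (by norm_num)]
  have h : √2 ≠ 0 := by positivity
  have h2 : √2 * √2 = 2 := Real.mul_self_sqrt (by norm_num)
  field_simp
  linear_combination -h2

/-- In the step from `m` to `m + 1` the norm gains `(2m+2)/(2m+1)` and the reciprocal Gamma value
gains `-(2m+1)/2`, together `-(m+1)`. The right side is `-2√2` times the derivative of `1/Γ(-ν/2)`
at `2m`, hence the later cancellation. -/
theorem inv_Gamma_mul_evenNorm (m : ℕ) :
    2 * ((Complex.Gamma (1 / 2 - m))⁻¹ * evenNorm (2 * m)) =
      (√2 : ℝ) * ((-1) ^ m * (m.factorial : ℂ)) := by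
  induction m with
  | zero =>
    have hpi : ((√Real.pi : ℝ) : ℂ) ≠ 0 := by
      exact_mod_cast (Real.sqrt_pos.2 Real.pi_pos).ne'
    have hG : Complex.Gamma (1 / 2) = ((√Real.pi : ℝ) : ℂ) := by
      have := Complex.Gamma_ofReal (1 / 2)
      rw [Real.Gamma_one_half_eq] at this
      simpa using this
    have h : (2 : ℂ) * ((√(Real.pi / 2) : ℝ) : ℂ) = (√2 : ℝ) * (√Real.pi : ℝ) := by
      exact_mod_cast two_sqrt_half_pi
    simp only [Nat.cast_zero, mul_zero, sub_zero, evenNorm_zero, hG, pow_zero,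
      Nat.factorial_zero, Nat.cast_one, mul_one]
    field_simp
    linear_combination h
  | succ m ih =>
    have hm : (2 * (m : ℂ) + 1) ≠ 0 := by exact_mod_cast Nat.succ_ne_zero (2 * m)
    rw [Complex.one_div_Gamma_eq_self_mul_one_div_Gamma_add_one,
      show (1 / 2 : ℂ) - ((m + 1 : ℕ) : ℂ) + 1 = 1 / 2 - m by push_cast; ring,
      evenNorm_succ_eq_mul_oddNorm, factorial_succ_cast, pow_succ]
    rw [evenNorm_eq_mul_oddNorm] at ih
    push_cast
    linear_combination -(m + 1 : ℂ) * ih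

theorem inv_Gamma_mul_oddNorm (m : ℕ) :
    2 * (√2 : ℝ) * ((Complex.Gamma (-1 / 2 - m))⁻¹ * oddNorm (2 * m + 1)) =
      -((-1) ^ m * (m.factorial : ℂ)) := by
  have h := inv_Gamma_mul_evenNorm m
  rw [evenNorm_eq_mul_oddNorm] at h
  rw [Complex.one_div_Gamma_eq_self_mul_one_div_Gamma_add_one,
    show (-1 / 2 : ℂ) - m + 1 = 1 / 2 - m by ring]
  have h2 : ((√2 : ℝ) : ℂ) * (√2 : ℝ) = 2 := by
    exact_mod_cast Real.mul_self_sqrt (by norm_num : (0 : ℝ) ≤ 2)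
  linear_combination -((√2 : ℝ) : ℂ) / 2 * h - ((-1) ^ m * (m.factorial : ℂ)) / 2 * h2

theorem exists_ofReal_weberEven (a x : ℝ) : ∃ r : ℝ, weberEven a x = r :=
  ⟨∑' k, (∏ j ∈ Finset.range k, (-a + 2 * (j : ℝ))) * x ^ (2 * k) / ((2 * k).factorial : ℝ), by
    rw [Complex.ofReal_tsum, weberEven]
    exact tsum_congr fun k => by rw [evenTerm]; push_cast; rfl⟩

theorem exists_ofReal_weberOdd (a x : ℝ) : ∃ r : ℝ, weberOdd a x = r :=
  ⟨∑' k, (∏ j ∈ Finset.range k, (-a + 1 + 2 * (j : ℝ))) * x ^ (2 * k + 1) /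
      ((2 * k + 1).factorial : ℝ), by
    rw [Complex.ofReal_tsum, weberOdd]
    exact tsum_congr fun k => by rw [oddTerm]; push_cast; rfl⟩

/-! ### `D` and `Φ` in terms of the power series. -/

/-- The coefficient in `D_ν(b) = 2^{ν/2} √π e^{-b²/4} · reducedD(ν)`. -/
noncomputable def reducedD (b : ℝ) (ν : ℂ) : ℂ :=
  (Complex.Gamma (-ν / 2 + 1 / 2))⁻¹ * weberEven ν b -
    (√2 : ℝ) * (Complex.Gamma (-ν / 2))⁻¹ * weberOdd ν b

theorem paramD_eq (b : ℝ) (ν : ℂ) : paramD b ν =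
    (2 : ℂ) ^ (ν / 2) * ((√Real.pi * Real.exp (-b ^ 2 / 4) : ℝ) : ℂ) * reducedD b ν := by
  have h2 : (2 : ℂ) ^ ((ν + 1) / 2) = (2 : ℂ) ^ (ν / 2) * (√2 : ℝ) := by
    rw [add_div, Complex.cpow_add _ _ two_ne_zero, Real.sqrt_eq_rpow,
      Complex.ofReal_cpow (by norm_num)]
    push_cast
    rfl
  rw [paramD, parabolicCylinderD, reducedD, h2, yEven, yOdd]
  change _ * (_ * weberEven ν b) - _ * (_ * weberOdd ν b) = _
  push_cast
  ring

theorem paramPhi_eq (b : ℝ) (ν : ℂ) : paramPhi b ν =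
    ((√(2 / Real.pi) * Real.exp (-b ^ 2 / 4) ^ 2 : ℝ) : ℂ) * (weberEven ν b * weberOdd ν b) := by
  rw [paramPhi, yEven, yOdd]
  change _ * (_ * weberEven ν b) * (_ * weberOdd ν b) = _
  push_cast
  ring

theorem differentiable_inv_Gamma_comp_even :
    Differentiable ℂ fun ν : ℂ => (Complex.Gamma (-ν / 2 + 1 / 2))⁻¹ :=
  Complex.differentiable_one_div_Gamma.comp
    (g := fun s => (Complex.Gamma s)⁻¹) (f := fun ν : ℂ => -ν / 2 + 1 / 2) (by fun_prop)

theorem differentiable_inv_Gamma_comp_odd :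
    Differentiable ℂ fun ν : ℂ => (Complex.Gamma (-ν / 2))⁻¹ :=
  Complex.differentiable_one_div_Gamma.comp
    (g := fun s => (Complex.Gamma s)⁻¹) (f := fun ν : ℂ => -ν / 2) (by fun_prop)

theorem differentiable_reducedD (b : ℝ) : Differentiable ℂ (reducedD b) :=
  (differentiable_inv_Gamma_comp_even.mul (differentiable_weberEven_param b)).sub
    ((differentiable_inv_Gamma_comp_odd.const_mul _).mul (differentiable_weberOdd_param b))

theorem differentiable_two_cpow_half : Differentiable ℂ fun ν : ℂ => (2 : ℂ) ^ (ν / 2) :=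
  Differentiable.const_cpow (by fun_prop) (Or.inl two_ne_zero)

theorem differentiable_paramD (b : ℝ) : Differentiable ℂ (paramD b) := by
  rw [funext (paramD_eq b)]
  exact (differentiable_two_cpow_half.mul_const _).mul (differentiable_reducedD b)

theorem differentiable_paramPhi (b : ℝ) : Differentiable ℂ (paramPhi b) := by
  rw [funext (paramPhi_eq b)]
  exact ((differentiable_weberEven_param b).mul (differentiable_weberOdd_param b)).const_mul _

theorem reducedD_eq_zero {b : ℝ} {ν : ℂ} (h : paramD b ν = 0) : reducedD b ν = 0 := by
  rw [paramD_eq] at h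
  refine (mul_eq_zero.1 h).resolve_left (mul_ne_zero (by simp) ?_)
  exact_mod_cast (mul_pos (Real.sqrt_pos.2 Real.pi_pos) (Real.exp_pos _)).ne'

/-- The zero of `reducedD` removes the derivative of the prefactor, leaving a positive real multiple
of `d`. -/
theorem hasDerivAt_paramD {b : ℝ} {n : ℕ} {d : ℂ} (h0 : reducedD b n = 0)
    (h : HasDerivAt (reducedD b) d n) : HasDerivAt (paramD b)
      (((2 : ℝ) ^ ((n : ℝ) / 2) * (√Real.pi * Real.exp (-b ^ 2 / 4)) : ℝ) * d) n := by
  have h1 := ((differentiable_two_cpow_half n).hasDerivAt.mul_const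
    ((√Real.pi * Real.exp (-b ^ 2 / 4) : ℝ) : ℂ)).mul h
  have h2 := h1.congr_of_eventuallyEq (Eventually.of_forall (paramD_eq b))
  refine h2.congr_deriv ?_
  have e : (2 : ℂ) ^ ((n : ℂ) / 2) = (((2 : ℝ) ^ ((n : ℝ) / 2) : ℝ) : ℂ) := by
    rw [Complex.ofReal_cpow (by norm_num)]
    push_cast
    rfl
  rw [h0, mul_zero, zero_add, e]
  simp only [Complex.ofReal_mul]

theorem hasDerivAt_inv_Gamma_even_factor (m : ℕ) :
    HasDerivAt (fun ν : ℂ => (Complex.Gamma (-ν / 2))⁻¹)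
      (-((-1) ^ m * (m.factorial : ℂ)) / 2) (2 * m) := by
  have h : HasDerivAt (fun ν : ℂ => -ν / 2) (-1 / 2) (2 * (m : ℂ)) :=
    (hasDerivAt_id _).neg.div_const 2
  have hg := hasDerivAt_inv_Gamma_neg_nat m
  rw [show -(m : ℂ) = -(2 * m) / 2 by ring] at hg
  refine (HasDerivAt.comp (2 * (m : ℂ)) hg h).congr_deriv ?_
  ring

theorem hasDerivAt_inv_Gamma_odd_factor (m : ℕ) :
    HasDerivAt (fun ν : ℂ => (Complex.Gamma (-ν / 2 + 1 / 2))⁻¹)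
      (-((-1) ^ m * (m.factorial : ℂ)) / 2) (2 * m + 1) := by
  have h : HasDerivAt (fun ν : ℂ => -ν / 2 + 1 / 2) (-1 / 2) (2 * (m : ℂ) + 1) :=
    ((hasDerivAt_id _).neg.div_const 2).add_const _
  have hg := hasDerivAt_inv_Gamma_neg_nat m
  rw [show -(m : ℂ) = -(2 * m + 1) / 2 + 1 / 2 by ring] at hg
  refine (HasDerivAt.comp (2 * (m : ℂ) + 1) hg h).congr_deriv ?_
  ring

theorem polynomial_weberEven_ne_zero {m : ℕ} {p : Polynomial ℝ}
    (hp : ∀ x : ℝ, weberEven (2 * m) x = (p.eval x : ℝ)) : p ≠ 0 := by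
  rintro rfl
  have := hp 0
  simp [weberEven_zero] at this

/-- The value at 0 is uninformative here; the slope there, equal to 1, is used instead. -/
theorem polynomial_weberOdd_ne_zero {m : ℕ} {p : Polynomial ℝ}
    (hp : ∀ x : ℝ, weberOdd (2 * m + 1) x = (p.eval x : ℝ)) : p ≠ 0 := by
  rintro rfl
  have h0 : ∀ x : ℝ, weberOdd (2 * m + 1) x = 0 := fun x => by simp [hp]
  have h := (hasDerivAt_weberOdd (2 * m + 1) ((0 : ℝ) : ℂ)).comp_ofReal
  have h' : HasDerivAt (fun x : ℝ => weberOdd (2 * m + 1) x) 0 0 := by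
    simpa only [h0] using hasDerivAt_const (0 : ℝ) (0 : ℂ)
  have := h.unique h'
  simp [weberEven_zero] at this

/-! ### Derivatives of `D` and `Φ` at an integer zero. -/

/-- At a zero of `ν ↦ D_ν(b)` at a natural number `n`, the derivatives in `ν` of `D_ν(b)` and of
`Φ` are real and nonzero, and that of `Φ`, which vanishes there, has the sign `(-1)^{n+1}`. Even case. -/
theorem exists_derivs_of_even {b : ℝ} (hb : 0 < b) {n m : ℕ} (hn : n = 2 * m)
    (hD : paramD b n = 0) :
    ∃ d p : ℝ, d ≠ 0 ∧ 0 < (-1) ^ (n + 1) * p ∧ HasDerivAt (paramD b) d n ∧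
      HasDerivAt (paramPhi b) p n ∧ paramPhi b n = 0 := by
  have hnc : (n : ℂ) = 2 * m := by rw [hn]; push_cast; rfl
  have hR := reducedD_eq_zero hD
  have hg0 : (Complex.Gamma (-(2 * m : ℂ) / 2))⁻¹ = 0 := by
    rw [show -(2 * m : ℂ) / 2 = -m by ring, Complex.Gamma_neg_nat_eq_zero, inv_zero]
  have eG : -(2 * m : ℂ) / 2 + 1 / 2 = 1 / 2 - m := by ring
  obtain ⟨γ, hγ⟩ : ∃ γ : ℝ, (Complex.Gamma (1 / 2 - m))⁻¹ = γ :=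
    ⟨(Real.Gamma (1 / 2 - m))⁻¹, by
      rw [Complex.ofReal_inv, ← Complex.Gamma_ofReal]; push_cast; rfl⟩
  have hfac := inv_Gamma_mul_evenNorm m
  have hγ0 : γ ≠ 0 := by
    rintro rfl
    rw [hγ] at hfac
    simp [Nat.factorial_ne_zero] at hfac
  have hE : weberEven (2 * m) b = 0 := by
    rw [hnc, reducedD, hg0, eG, hγ] at hR
    simpa [hγ0] using hR
  have hw := weber_wronskian (2 * m) b
  rw [hE] at hw
  obtain ⟨v, hv⟩ : ∃ v : ℝ, weberOdd (2 * m) b = v := by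
    simpa using exists_ofReal_weberOdd (2 * m) b
  have hv0 : v ≠ 0 := by
    rintro rfl
    simp [hv] at hw
  obtain ⟨q, hq⟩ := exists_polynomial_weberEven m
  obtain ⟨I, T, hI, hT, hI', hT'⟩ := exists_norm_tail (f := fun x : ℝ => weberEven (2 * m) x)
    (polynomial_weberEven_ne_zero hq) hq hb
  change evenNorm (2 * m) = _ at hT'
  have hE' := hasDerivAt_weberEven_param hE
  rw [hI', hv] at hE'
  have hO' := (differentiable_weberOdd_param b (2 * m)).hasDerivAt
  -- The product rule gives `-γ v I + √2 (-1)^m m! v / 2`; by `hfac` the second term is `γ v (I +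
  -- T)`, so only the tail `T` remains.
  have hd : HasDerivAt (reducedD b) ((v * γ * T : ℝ) : ℂ) n := by
    rw [hnc]
    refine HasDerivAt.congr_deriv
      (((differentiable_inv_Gamma_comp_even (2 * m)).hasDerivAt.mul hE').sub
      (((hasDerivAt_inv_Gamma_even_factor m).const_mul _).mul hO')) ?_
    rw [hg0, hE, hv, eG, hγ]
    rw [hγ, hT'] at hfac
    push_cast
    linear_combination (-(v : ℂ) / 2) * hfac
  have hp : HasDerivAt (paramPhi b)
      (((√(2 / Real.pi) * Real.exp (-b ^ 2 / 4) ^ 2) * -(v ^ 2 * I) : ℝ) : ℂ) n := by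
    rw [hnc]
    refine (((hE'.mul hO').const_mul _).congr_of_eventuallyEq
      (Eventually.of_forall (paramPhi_eq b))).congr_deriv ?_
    rw [hE, hv]
    push_cast
    ring
  refine ⟨_, _, ?_, ?_, (hasDerivAt_paramD hR hd).congr_deriv (Complex.ofReal_mul _ _).symm,
    hp, by rw [paramPhi_eq, hnc, hE]; simp⟩
  · positivity
  · rw [hn, pow_succ, pow_mul]
    have : 0 < √(2 / Real.pi) := Real.sqrt_pos.2 (by positivity)
    have : 0 < (√(2 / Real.pi) * Real.exp (-b ^ 2 / 4) ^ 2) * (v ^ 2 * I) := by positivity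
    simpa using this

/-- The analogue of `exists_derivs_of_even` for odd `n`. -/
theorem exists_derivs_of_odd {b : ℝ} (hb : 0 < b) {n m : ℕ} (hn : n = 2 * m + 1)
    (hD : paramD b n = 0) :
    ∃ d p : ℝ, d ≠ 0 ∧ 0 < (-1) ^ (n + 1) * p ∧ HasDerivAt (paramD b) d n ∧
      HasDerivAt (paramPhi b) p n ∧ paramPhi b n = 0 := by
  have hnc : (n : ℂ) = 2 * m + 1 := by rw [hn]; push_cast; rfl
  have hR := reducedD_eq_zero hD
  have hg0 : (Complex.Gamma (-(2 * m + 1 : ℂ) / 2 + 1 / 2))⁻¹ = 0 := by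
    rw [show -(2 * m + 1 : ℂ) / 2 + 1 / 2 = -m by ring, Complex.Gamma_neg_nat_eq_zero, inv_zero]
  have eG : -(2 * m + 1 : ℂ) / 2 = -1 / 2 - m := by ring
  obtain ⟨γ, hγ⟩ : ∃ γ : ℝ, (Complex.Gamma (-1 / 2 - m))⁻¹ = γ :=
    ⟨(Real.Gamma (-1 / 2 - m))⁻¹, by
      rw [Complex.ofReal_inv, ← Complex.Gamma_ofReal]; push_cast; rfl⟩
  have hfac := inv_Gamma_mul_oddNorm m
  have hγ0 : γ ≠ 0 := by
    rintro rfl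
    rw [hγ] at hfac
    simp [Nat.factorial_ne_zero] at hfac
  have hO : weberOdd (2 * m + 1) b = 0 := by
    rw [hnc, reducedD, hg0, eG, hγ] at hR
    simpa [hγ0] using hR
  have hw := weber_wronskian (2 * m + 1) b
  rw [hO] at hw
  obtain ⟨u, hu⟩ : ∃ u : ℝ, weberEven (2 * m + 1) b = u := by
    simpa using exists_ofReal_weberEven (2 * m + 1) b
  have hu0 : u ≠ 0 := by
    rintro rfl
    simp [hu] at hw
  obtain ⟨q, hq⟩ := exists_polynomial_weberOdd m
  obtain ⟨I, T, hI, hT, hI', hT'⟩ := exists_norm_tail (f := fun x : ℝ => weberOdd (2 * m + 1) x)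
    (polynomial_weberOdd_ne_zero hq) hq hb
  change oddNorm (2 * m + 1) = _ at hT'
  have hO' := hasDerivAt_weberOdd_param hO
  rw [hI', hu] at hO'
  have hE' := (differentiable_weberEven_param b (2 * m + 1)).hasDerivAt
  -- Here the terms are `-√2 γ u I` and, by `hfac`, `√2 γ u (I + T)`.
  have hd : HasDerivAt (reducedD b) ((u * √2 * γ * T : ℝ) : ℂ) n := by
    rw [hnc]
    refine HasDerivAt.congr_deriv
      (((hasDerivAt_inv_Gamma_odd_factor m).mul hE').sub
      (((differentiable_inv_Gamma_comp_odd (2 * m + 1)).hasDerivAt.const_mul _).mul hO')) ?_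
    rw [hg0, hO, hu, eG, hγ]
    rw [hγ, hT'] at hfac
    push_cast
    linear_combination (-(u : ℂ) / 2) * hfac
  have hp : HasDerivAt (paramPhi b)
      (((√(2 / Real.pi) * Real.exp (-b ^ 2 / 4) ^ 2) * (u ^ 2 * I) : ℝ) : ℂ) n := by
    rw [hnc]
    refine (((hE'.mul hO').const_mul _).congr_of_eventuallyEq
      (Eventually.of_forall (paramPhi_eq b))).congr_deriv ?_
    rw [hO, hu]
    push_cast
    ring
  refine ⟨_, _, ?_, ?_, (hasDerivAt_paramD hR hd).congr_deriv (Complex.ofReal_mul _ _).symm,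
    hp, by rw [paramPhi_eq, hnc, hO]; simp⟩
  · positivity
  · rw [hn, show 2 * m + 1 + 1 = 2 * (m + 1) by ring, pow_mul]
    have : 0 < √(2 / Real.pi) := Real.sqrt_pos.2 (by positivity)
    have : 0 < (√(2 / Real.pi) * Real.exp (-b ^ 2 / 4) ^ 2) * (u ^ 2 * I) := by positivity
    simpa using this

/-! ### Local factorisation of `M` and its leading coefficient. -/

/-- Division of an entire function by a linear factor at a zero. -/
theorem exists_entire_eq_sub_mul {f : ℂ → ℂ} {z d : ℂ} (hf : Differentiable ℂ f)
    (h0 : f z = 0) (hd : HasDerivAt f d z) :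
    ∃ g : ℂ → ℂ, Differentiable ℂ g ∧ g z = d ∧ ∀ w, f w = (w - z) * g w := by
  refine ⟨dslope f z, ?_, ?_, fun w => ?_⟩
  · exact differentiableOn_univ.1
      ((Complex.differentiableOn_dslope univ_mem).2 hf.differentiableOn)
  · rw [dslope_same, hd.deriv]
  · simpa [h0] using (sub_smul_dslope f z w).symm

theorem hasDerivAt_inv_Gamma_neg (n : ℕ) :
    HasDerivAt (fun ν : ℂ => (Complex.Gamma (-ν))⁻¹) ((-1) ^ (n + 1) * (n.factorial : ℂ)) n := by
  refine (HasDerivAt.comp (n : ℂ) (hasDerivAt_inv_Gamma_neg_nat n)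
    (hasDerivAt_neg (n : ℂ))).congr_deriv ?_
  ring

theorem exists_derivs {b : ℝ} (hb : 0 < b) {n : ℕ} (hD : paramD b n = 0) :
    ∃ d p : ℝ, d ≠ 0 ∧ 0 < (-1) ^ (n + 1) * p ∧ HasDerivAt (paramD b) d n ∧
      HasDerivAt (paramPhi b) p n ∧ paramPhi b n = 0 := by
  rcases n.even_or_odd' with ⟨m, hm | hm⟩
  · exact exists_derivs_of_even hb hm hD
  · exact exists_derivs_of_odd hb hm hD

theorem mainTheorem7 (b : ℝ) (hb : 0 < b) (n : ℕ) (hn : 1 ≤ n)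
    (hD : paramD b (n : ℂ) = 0) :
    analyticOrderAt (paramD b) (n : ℂ) = 1 ∧
    analyticOrderAt (paramPhi b) (n : ℂ) = 1 ∧
    AnalyticAt ℂ (paramMExt b n) (n : ℂ) ∧
    analyticOrderAt (paramMExt b n) (n : ℂ) = 2 ∧
    ∃ c₂ : ℝ, 0 < c₂ ∧
      (fun ν : ℂ => paramMExt b n ν - (c₂ : ℂ) * (ν - (n : ℂ)) ^ 2) =O[𝓝 (n : ℂ)]
        (fun ν : ℂ => (ν - (n : ℂ)) ^ 3) := by
  obtain ⟨d, p, hd, hp, hD', hΦ', hΦ⟩ := exists_derivs hb hD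
  have hp0 : p ≠ 0 := by
    rintro rfl
    simp at hp
  have hG : Differentiable ℂ fun ν : ℂ => (Complex.Gamma (-ν))⁻¹ :=
    Complex.differentiable_one_div_Gamma.comp
      (g := fun s => (Complex.Gamma s)⁻¹) differentiable_neg
  obtain ⟨f, hf, hfn, hfe⟩ := exists_entire_eq_sub_mul (differentiable_paramD b) hD hD'
  obtain ⟨φ, hφ, hφn, hφe⟩ := exists_entire_eq_sub_mul (differentiable_paramPhi b) hΦ hΦ'
  obtain ⟨γ, hγ, hγn, hγe⟩ := exists_entire_eq_sub_mul hG
    (by rw [Complex.Gamma_neg_nat_eq_zero, inv_zero]) (hasDerivAt_inv_Gamma_neg n)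
  have hγ0 : γ n ≠ 0 := by
    rw [hγn]
    simp [Nat.factorial_ne_zero]
  set h : ℂ → ℂ := fun ν => f ν ^ 2 * φ ν / γ ν with hh
  have han : AnalyticAt ℂ h n :=
    (((hf.analyticAt _).pow 2).mul (hφ.analyticAt _)).div (hγ.analyticAt _) hγ0
  have hMne : ∀ ν : ℂ, ν ≠ n → paramM b ν = (ν - n) ^ 2 * h ν := fun ν hν => by
    have hν' : ν - n ≠ 0 := sub_ne_zero.2 hν
    rw [paramM, hfe, hφe, ← inv_inv (Complex.Gamma (-ν)), hγe]
    simp only [hh]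
    -- At the other poles of `Γ(-ν)` both sides are 0: there `Complex.Gamma` takes its default
    -- value, and so does the division by `γ ν = 0`.
    by_cases h0 : γ ν = 0
    · simp [h0]
    · field_simp
  have hprod : AnalyticAt ℂ (fun ν : ℂ => (ν - n) ^ 2 * h ν) n :=
    ((analyticAt_id.sub analyticAt_const).pow 2).mul han
  have hlim : Tendsto (paramM b) (𝓝[≠] (n : ℂ)) (𝓝 0) := by
    have h1 := hprod.continuousAt.tendsto.mono_left (nhdsWithin_le_nhds (s := {(n : ℂ)}ᶜ))
    simp only [sub_self, ne_eq, OfNat.ofNat_ne_zero, not_false_eq_true, zero_pow, zero_mul] at h1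
    refine h1.congr' ?_
    filter_upwards [self_mem_nhdsWithin] with ν hν
    exact (hMne ν hν).symm
  have hext : paramMExt b n = fun ν : ℂ => (ν - n) ^ 2 * h ν := by
    funext ν
    rcases eq_or_ne ν n with rfl | hν
    · simp [paramMExt, hlim.limUnder_eq]
    · rw [paramMExt, Function.update_of_ne hν, hMne ν hν]
  set c : ℝ := d ^ 2 * p / ((-1) ^ (n + 1) * n.factorial) with hc
  have hhn : h n = c := by
    simp only [hh, hfn, hφn, hγn, hc]
    push_cast
    rfl
  have hc0 : 0 < c := by
    -- Moving the sign from the denominator to `p` exposes the positive quantity `hp`.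
    have e : c = d ^ 2 * ((-1) ^ (n + 1) * p) / n.factorial := by
      have h1 : ((-1 : ℝ) ^ (n + 1)) * (-1) ^ (n + 1) = 1 := by
        rw [← mul_pow]
        simp
      have h2 : ((-1 : ℝ) ^ (n + 1)) ≠ 0 := by simp
      have h3 : (n.factorial : ℝ) ≠ 0 := by exact_mod_cast n.factorial_ne_zero
      rw [hc, div_eq_div_iff (mul_ne_zero h2 h3) h3]
      linear_combination (-(d ^ 2 * p * n.factorial)) * h1
    rw [e]
    positivity
  have hc0' : (c : ℂ) ≠ 0 := by exact_mod_cast hc0.ne'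
  refine ⟨?_, ?_, hext ▸ hprod, ?_, c, hc0, ?_⟩
  · refine ((differentiable_paramD b).analyticAt _).analyticOrderAt_eq_one_of_zero_deriv_ne_zero
      hD ?_
    rw [hD'.deriv]
    exact_mod_cast hd
  · refine ((differentiable_paramPhi b).analyticAt _).analyticOrderAt_eq_one_of_zero_deriv_ne_zero
      hΦ ?_
    rw [hΦ'.deriv]
    exact_mod_cast hp0
  · rw [hext]
    exact (hprod.analyticOrderAt_eq_natCast (n := 2)).2
      ⟨h, han, hhn ▸ hc0', Eventually.of_forall fun _ => rfl⟩
  · rw [hext]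
    -- The cubic error is `(ν - n)²` times the first-order error of `h` at `n`.
    have h1 : (fun ν : ℂ => h ν - h n) =O[𝓝 (n : ℂ)] fun ν => ν - n :=
      han.differentiableAt.isBigO_sub
    refine ((isBigO_refl (fun ν : ℂ => (ν - n) ^ 2) (𝓝 (n : ℂ))).mul h1).congr (fun ν => ?_)
      fun ν => ?_
    · rw [hhn]
      ring
    · ring
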